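/- A sequence $\{c_n\}_{n\ge 0}$ of complex numbers belongs to the class NBVS if there is $\theta_0\in[0,\pi/2)$ such that $c_n\in M(\theta_0):=\{z\in\mathbb C: |\arg z|\le\theta_0\}$ for all $n\ge 1$ (with the convention $\arg 0=0$, so that $0\in M(\theta_0)$), and there is a constant $K>0$ such that $$\sum_{n=m}^{2m}|c_n-c_{n+1}|\le K\big(|c_m|+|c_{2m}|\big)\qquad\text{for all } m=1,2,\dots.$$ Let $L_{2\pi}$ be the space of complex-valued $2\pi$-periodic functions on $\mathbb R$ that are integrable over a period, with the norm $\|f\|_L=\int_{-\pi}^{\pi}|f(x)|\,dx$. For $f\in L_{2\pi}$ and $k\in\mathbb Z$ let $\hat f(k)=\frac1{2\pi}\int_{-\pi}^{\pi}f(x)e^{-ikx}\,dx$, and for $n\ge 0$ let $S_n(f)(x)=\sum_{k=-n}^{n}\hat f(k)e^{ikx}$. **Corollary 2.** Let $f\in L_{2\pi}$ be real-valued. If $\{\hat f(n)\}_{n\ge 0}\in$ NBVS, then $$\lim_{n\to\infty}\|f-S_n(f)\|_L=0\quad\text{if and only if}\quad\lim_{n\to\infty}\hat f(n)\log n=0.$$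 -/

import Mathlib

namespace FourierNBV

open scoped Real

/-- The sector `M(θ₀) = {z : |arg z| ≤ θ₀}`; it contains `0`, since `Complex.arg 0 = 0`. -/
def sector (θ₀ : ℝ) : Set ℂ := {z | |Complex.arg z| ≤ θ₀}

/-- The class `NBVS`: from index `1` on, the terms lie in a sector `M(θ₀)` with `0 ≤ θ₀ < π / 2`,
and `∑_{n = m}^{2m} |Δ c_n| ≤ K (|c_m| + |c_{2m}|)` for all `m ≥ 1`, with one constant `K` and
`Δ c_n = c_n - c_{n+1}`. -/
def NBVS (c : ℕ → ℂ) : Prop :=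
  (∃ θ₀ ∈ Set.Ico (0 : ℝ) (π / 2), ∀ n : ℕ, 1 ≤ n → c n ∈ sector θ₀) ∧
  ∃ K : ℝ, 0 < K ∧ ∀ m : ℕ, 1 ≤ m →
    ∑ n ∈ Finset.Icc m (2 * m), ‖c n - c (n + 1)‖ ≤ K * (‖c m‖ + ‖c (2 * m)‖)

/-- The space `L_{2π}` of complex valued `2π`-periodic functions, integrable over a period. -/
def MemL2pi (f : ℝ → ℂ) : Prop :=
  Function.Periodic f (2 * π) ∧ IntervalIntegrable f MeasureTheory.volume (-π) π

/-- The norm of `L_{2π}`. -/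
noncomputable def normL (f : ℝ → ℂ) : ℝ := ∫ x in (-π)..π, ‖f x‖

/-- The Fourier coefficient `(2π)⁻¹ ∫_{-π}^{π} f(x) e^{-inx} dx`. -/
noncomputable def coeff (f : ℝ → ℂ) (n : ℤ) : ℂ :=
  fourierCoeffOn (neg_lt_self Real.pi_pos) f n

/-- The symmetric partial sum `S_n(f, x) = ∑_{k = -n}^{n} f̂(k) e^{ikx}`. -/
noncomputable def partialSum (f : ℝ → ℂ) (n : ℕ) (x : ℝ) : ℂ :=
  ∑ k ∈ Finset.Icc (-(n : ℤ)) (n : ℤ), coeff f k * Complex.exp (Complex.I * (k : ℂ) * (x : ℂ))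

end FourierNBV

namespace FourierNBV

open scoped Real ComplexConjugate
open MeasureTheory Filter Topology

/-! Write `c k` for the `k`-th coefficient of `f`, so that `c (-k)` is the conjugate of `c k`.

Sufficiency: the de la Vallée Poussin means `V_n f` converge to `f` in norm for every integrable
`f`, because they have norm at most `3` and eventually fix each trigonometric polynomial. The
difference `V_n f - S_n f` averages `S_m f - S_n f` over `n ≤ m < 2n`. Abel summation and NBVS bound
each of these by a constant times `(‖c n‖ + ‖c (2n)‖) * n / (1 + n|x|)`, whose integral is of order
`(‖c n‖ + ‖c (2n)‖) log n`.

Necessity: `S_{2n} f - S_n f` tends to `0` in norm. Pairing it with the bounded function `x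
e^{-inx}` on `[0, 2π]` produces `∑ (c k / (k - n) - conj (c k) / (k + n))` over `n < k ≤ 2n`. The
sector condition makes its real part dominate `∑ ‖c k‖ / (k - n)`, which therefore tends to `0`.
NBVS bounds `‖c N‖` by a multiple of `‖c k‖ + ‖c (2k)‖` whenever `k ≤ N ≤ 2k`; averaging this with
the weights `1 / (k - n)`, `n = N / 2`, whose sum is at least `log (n + 1)`, gives `c N log N → 0`.
-/

/-! ### Fourier coefficients and integrals of exponentials. -/

theorem coeff_eq (f : ℝ → ℂ) (n : ℤ) :
    coeff f n = (2 * π : ℂ)⁻¹ * ∫ x in (-π)..π, f x * Complex.exp (-(Complex.I * n * x)) := by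
  rw [coeff, fourierCoeffOn_eq_integral, Complex.real_smul]
  congr 1
  · push_cast
    rw [one_div]
    congr 1
    ring
  · refine intervalIntegral.integral_congr fun x _ => ?_
    simp only [fourier_coe_apply, smul_eq_mul]
    rw [mul_comm]
    congr 2
    have : (π : ℂ) ≠ 0 := by exact_mod_cast Real.pi_ne_zero
    push_cast
    field_simp
    ring

theorem coeff_neg_of_real (f : ℝ → ℝ) (n : ℤ) :
    coeff (fun x => (f x : ℂ)) (-n) = conj (coeff (fun x => (f x : ℂ)) n) := by
  rw [coeff_eq, coeff_eq, map_mul, intervalIntegral.integral_of_le (by linarith [Real.pi_pos]),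
    intervalIntegral.integral_of_le (by linarith [Real.pi_pos]), ← integral_conj]
  congr 1
  · simp [map_ofNat]
  · congr 1
    ext x
    simp [← Complex.exp_conj]

theorem intervalIntegrable_mul_exp {f : ℝ → ℂ} {a b : ℝ} (hf : IntervalIntegrable f volume a b)
    (n : ℤ) :
    IntervalIntegrable (fun x : ℝ => f x * Complex.exp (-(Complex.I * n * x))) volume a b :=
  hf.mul_continuousOn (by fun_prop)

theorem integral_exp_int (k : ℤ) :
    ∫ x : ℝ in (-π)..π, Complex.exp (Complex.I * k * x) = if k = 0 then 2 * (π : ℂ) else 0 := by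
  split_ifs with h
  · subst h
    simp
    ring
  · have hk : Complex.I * (k : ℂ) ≠ 0 := mul_ne_zero Complex.I_ne_zero (by exact_mod_cast h)
    rw [integral_exp_mul_complex hk]
    have : Complex.exp (Complex.I * k * (π : ℝ)) = Complex.exp (Complex.I * k * (-π : ℝ)) :=
      Complex.exp_eq_exp_iff_exists_int.2 ⟨k, by push_cast; ring⟩
    rw [this, sub_self, zero_div]

theorem integral_mul_exp_int {k : ℤ} (hk : k ≠ 0) :
    ∫ x : ℝ in (0)..(2 * π), (x : ℂ) * Complex.exp (Complex.I * k * x) =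
      2 * π / (Complex.I * k) := by
  have hk' : Complex.I * (k : ℂ) ≠ 0 := mul_ne_zero Complex.I_ne_zero (by exact_mod_cast hk)
  have hd : ∀ x ∈ Set.uIcc 0 (2 * π), HasDerivAt (fun x : ℝ =>
      ((x : ℂ) / (Complex.I * k) - 1 / (Complex.I * k) ^ 2) * Complex.exp (Complex.I * k * x))
      ((x : ℂ) * Complex.exp (Complex.I * k * x)) x := by
    intro x _
    have h1 : HasDerivAt (fun x : ℝ => (x : ℂ)) 1 x := Complex.ofRealCLM.hasDerivAt
    have h2 := ((h1.div_const (Complex.I * k)).sub_const (1 / (Complex.I * k) ^ 2)).mul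
      ((h1.const_mul (Complex.I * (k : ℂ))).cexp)
    refine h2.congr_deriv ?_
    field_simp
    ring
  rw [intervalIntegral.integral_eq_sub_of_hasDerivAt hd (Continuous.intervalIntegrable (by fun_prop) _ _)]
  have : Complex.exp (Complex.I * k * ((2 * π : ℝ) : ℂ)) = 1 :=
    Complex.exp_eq_one_iff.2 ⟨k, by push_cast; ring⟩
  rw [this]
  simp

/-! ### Dirichlet and Fejér kernels. -/

/-- The Dirichlet kernel `∑_{|k| ≤ n} e^{ikx}`. -/
noncomputable def dirichlet (n : ℕ) (x : ℝ) : ℂ :=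
  ∑ k ∈ Finset.Icc (-(n : ℤ)) (n : ℤ), Complex.exp (Complex.I * (k : ℂ) * (x : ℂ))

theorem sum_Icc_neg_succ {M : Type*} [AddCommMonoid M] (h : ℤ → M) (n : ℕ) :
    ∑ k ∈ Finset.Icc (-((n + 1 : ℕ) : ℤ)) ((n + 1 : ℕ) : ℤ), h k =
      ∑ k ∈ Finset.Icc (-(n : ℤ)) (n : ℤ), h k + (h (n + 1 : ℕ) + h (-(n + 1 : ℕ))) := by
  have : Finset.Icc (-((n + 1 : ℕ) : ℤ)) ((n + 1 : ℕ) : ℤ) =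
      insert ((n + 1 : ℕ) : ℤ) (insert (-((n + 1 : ℕ) : ℤ)) (Finset.Icc (-(n : ℤ)) (n : ℤ))) := by
    ext k
    simp only [Finset.mem_Icc, Finset.mem_insert]
    omega
  rw [this, Finset.sum_insert (by simp; omega), Finset.sum_insert (by simp)]
  abel

/-- Fejér's identity. It is needed for positivity: the norm of the summed kernel is then simply its
integral. -/
theorem sum_range_dirichlet (N : ℕ) (x : ℝ) :
    ∑ m ∈ Finset.range N, dirichlet m x =
      ((‖∑ k ∈ Finset.range N, Complex.exp (Complex.I * x) ^ k‖ ^ 2 : ℝ) : ℂ) := by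
  set z := Complex.exp (Complex.I * x) with hz
  set w := Complex.exp (-(Complex.I * x)) with hw
  have hzw : z * w = 1 := by rw [hz, hw, ← Complex.exp_add]; simp
  have hconj : conj z = w := by rw [hz, hw, ← Complex.exp_conj]; simp
  have hD : ∀ m, dirichlet (m + 1) x = dirichlet m x + (z ^ (m + 1) + w ^ (m + 1)) := by
    intro m
    rw [dirichlet, dirichlet, sum_Icc_neg_succ, hz, hw, ← Complex.exp_nat_mul,
      ← Complex.exp_nat_mul]
    congr 3 <;> push_cast <;> ring_nf
  have hG : ∀ (u : ℂ) N, ∑ k ∈ Finset.range (N + 1), u ^ k =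
      1 + u * ∑ k ∈ Finset.range N, u ^ k := by
    intro u N
    rw [Finset.sum_range_succ', Finset.mul_sum]
    simp only [pow_succ', pow_zero]
    ring
  -- In this form, with `1 = z ^ N * w ^ N`, the kernel is exactly the increment from `N` to `N + 1`
  -- of the product of the geometric sums in `z` and `w`.
  have hD' : ∀ N, dirichlet N x = 1 + w ^ N * ∑ k ∈ Finset.range N, z ^ k +
      z ^ N * ∑ k ∈ Finset.range N, w ^ k := by
    intro N
    induction N with
    | zero => simp [dirichlet]
    | succ N ih =>
      rw [hD, ih, hG, hG]
      linear_combination (-w ^ N * ∑ k ∈ Finset.range N, z ^ k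
        - z ^ N * ∑ k ∈ Finset.range N, w ^ k) * hzw
  have hpow : ∀ N, z ^ N * w ^ N = 1 := fun N => by rw [← mul_pow, hzw, one_pow]
  have hG2 : ((‖∑ k ∈ Finset.range N, z ^ k‖ ^ 2 : ℝ) : ℂ) =
      (∑ k ∈ Finset.range N, z ^ k) * ∑ k ∈ Finset.range N, w ^ k := by
    rw [Complex.ofReal_pow, ← Complex.mul_conj', map_sum]
    simp [hconj]
  rw [hG2]
  clear hG2
  induction N with
  | zero => simp
  | succ N ih =>
    rw [Finset.sum_range_succ, ih, Finset.sum_range_succ, Finset.sum_range_succ, hD']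
    linear_combination -hpow N

theorem continuous_dirichlet (n : ℕ) : Continuous (dirichlet n) := by
  unfold dirichlet
  fun_prop

theorem exp_int_periodic (k : ℤ) :
    Function.Periodic (fun x : ℝ => Complex.exp (Complex.I * k * x)) (2 * π) := by
  intro x
  exact Complex.exp_eq_exp_iff_exists_int.2 ⟨k, by push_cast; ring⟩

theorem dirichlet_periodic (n : ℕ) : Function.Periodic (dirichlet n) (2 * π) := by
  intro x
  exact Finset.sum_congr rfl fun k _ => exp_int_periodic k x

theorem integral_dirichlet (n : ℕ) : ∫ x in (-π)..π, dirichlet n x = 2 * π := by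
  unfold dirichlet
  rw [intervalIntegral.integral_finsetSum
    fun k _ => Continuous.intervalIntegrable (by fun_prop) _ _]
  simp_rw [integral_exp_int]
  simp

theorem partialSum_eq_integral {g : ℝ → ℂ} (hg : IntervalIntegrable g volume (-π) π) (n : ℕ)
    (x : ℝ) :
    partialSum g n x = (2 * π : ℂ)⁻¹ * ∫ t in (-π)..π, g t * dirichlet n (x - t) := by
  simp_rw [partialSum, dirichlet, Finset.mul_sum]
  rw [intervalIntegral.integral_finsetSum fun k _ => hg.mul_continuousOn (by fun_prop),
    Finset.mul_sum]
  refine Finset.sum_congr rfl fun k _ => ?_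
  rw [coeff_eq, mul_assoc, ← intervalIntegral.integral_mul_const]
  congr 1
  refine intervalIntegral.integral_congr fun t _ => ?_
  rw [mul_assoc, ← Complex.exp_add]
  push_cast
  ring_nf

/-! ### Partial sums and the norm of `L_{2π}`. -/

theorem continuous_partialSum (f : ℝ → ℂ) (n : ℕ) : Continuous (partialSum f n) := by
  unfold partialSum
  fun_prop

theorem partialSum_sub_partialSum (f : ℝ → ℂ) {n m : ℕ} (h : n ≤ m) (x : ℝ) :
    partialSum f m x - partialSum f n x = ∑ k ∈ Finset.Ioc n m,
      (coeff f k * Complex.exp (Complex.I * k * x) +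
        coeff f (-k) * Complex.exp (-(Complex.I * k * x))) := by
  induction m, h using Nat.le_induction with
  | base => simp
  | succ m h ih =>
    rw [← Finset.insert_Ioc_right_eq_Ioc_add_one h, Finset.sum_insert (by simp), ← ih, partialSum,
      sum_Icc_neg_succ, ← partialSum]
    push_cast
    ring_nf

theorem neg_pi_le_pi : -π ≤ π := by linarith [Real.pi_pos]

theorem normL_nonneg (f : ℝ → ℂ) : 0 ≤ normL f :=
  intervalIntegral.integral_nonneg neg_pi_le_pi fun _ _ => norm_nonneg _

theorem normL_le {f : ℝ → ℂ} {h : ℝ → ℝ} (hf : IntervalIntegrable f volume (-π) π)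
    (hh : IntervalIntegrable h volume (-π) π) (H : ∀ x ∈ Set.Icc (-π) π, ‖f x‖ ≤ h x) :
    normL f ≤ ∫ x in (-π)..π, h x :=
  intervalIntegral.integral_mono_on neg_pi_le_pi hf.norm hh H

theorem normL_add_le {f g : ℝ → ℂ} (hf : IntervalIntegrable f volume (-π) π)
    (hg : IntervalIntegrable g volume (-π) π) :
    normL (fun x => f x + g x) ≤ normL f + normL g := by
  rw [normL, normL, normL, ← intervalIntegral.integral_add hf.norm hg.norm]
  exact normL_le (hf.add hg) (hf.norm.add hg.norm) fun x _ => norm_add_le _ _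

theorem normL_sub_le {f g h : ℝ → ℂ} (hf : IntervalIntegrable f volume (-π) π)
    (hg : IntervalIntegrable g volume (-π) π) (hh : IntervalIntegrable h volume (-π) π) :
    normL (fun x => f x - h x) ≤ normL (fun x => f x - g x) + normL (fun x => g x - h x) := by
  refine le_of_eq_of_le ?_ (normL_add_le (hf.sub hg) (hg.sub hh))
  congr 1
  ext x
  ring

theorem normL_sub_comm (f g : ℝ → ℂ) :
    normL (fun x => f x - g x) = normL (fun x => g x - f x) := by
  simp only [normL, norm_sub_rev]

theorem intervalIntegrable_partialSum (f : ℝ → ℂ) (n : ℕ) (a b : ℝ) :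
    IntervalIntegrable (partialSum f n) volume a b :=
  (continuous_partialSum f n).intervalIntegrable _ _

/-! ### Convolution and the de la Vallée Poussin means. -/

/-- Young's inequality in `L¹`: Fubini, plus translation invariance of the integral of a periodic
function over a period. -/
theorem normL_convolution_le {g K : ℝ → ℂ} (hg : IntervalIntegrable g volume (-π) π)
    (hK : Continuous K) (hper : Function.Periodic K (2 * π)) :
    normL (fun x => ∫ t in (-π)..π, g t * K (x - t)) ≤ normL g * normL K := by
  have hKn : ∀ t, ∫ x in (-π)..π, ‖K (x - t)‖ = normL K := by
    intro t
    rw [intervalIntegral.integral_comp_sub_right (fun x => ‖K x‖) t]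
    have := (hper.comp norm).intervalIntegral_add_eq (-π - t) (-π)
    simp only [Function.comp_def] at this
    rw [normL]
    convert this using 2 <;> ring
  -- A uniform bound on the kernel supplies the joint integrability that Fubini requires.
  obtain ⟨C, hC⟩ : ∃ C, ∀ x, ‖K x‖ ≤ C := by
    obtain ⟨C, hC⟩ := isCompact_Icc.exists_bound_of_continuousOn
      (s := Set.Icc 0 (2 * π)) hK.continuousOn
    refine ⟨C, fun x => ?_⟩
    obtain ⟨y, hy, hxy⟩ := hper.exists_mem_Ico₀ Real.two_pi_pos x
    rw [hxy]
    exact hC y (Set.Ico_subset_Icc_self hy)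
  rw [intervalIntegrable_iff_integrableOn_Ioc_of_le neg_pi_le_pi] at hg
  have hint : Integrable (Function.uncurry fun x t => g t * K (x - t))
      ((volume.restrict (Set.Ioc (-π) π)).prod (volume.restrict (Set.Ioc (-π) π))) := by
    have h1 : Integrable (fun z : ℝ × ℝ => g z.2)
        ((volume.restrict (Set.Ioc (-π) π)).prod (volume.restrict (Set.Ioc (-π) π))) :=
      hg.comp_snd _
    exact h1.mul_bdd (c := C) (by fun_prop : Continuous fun z : ℝ × ℝ => K (z.1 - z.2)).aestronglyMeasurable
      (.of_forall fun z => hC _)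
  have hswap := integral_integral_swap (f := fun x t => ‖g t * K (x - t)‖) hint.norm
  simp only [normL, intervalIntegral.integral_of_le neg_pi_le_pi] at hKn ⊢
  calc ∫ x in Set.Ioc (-π) π, ‖∫ t in Set.Ioc (-π) π, g t * K (x - t)‖
      ≤ ∫ x in Set.Ioc (-π) π, ∫ t in Set.Ioc (-π) π, ‖g t * K (x - t)‖ :=
        integral_mono hint.integral_prod_left.norm hint.norm.integral_prod_left
          fun x => norm_integral_le_integral_norm _
    _ = _ := by
        rw [hswap, ← integral_mul_const]
        refine integral_congr_ae (.of_forall fun t => ?_)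
        simp only [norm_mul]
        rw [integral_const_mul, hKn t]

/-- The de la Vallée Poussin mean `n⁻¹ ∑_{n ≤ m < 2n} S_m(g)`. -/
noncomputable def valleePoussin (n : ℕ) (g : ℝ → ℂ) (x : ℝ) : ℂ :=
  (n : ℂ)⁻¹ * ∑ m ∈ Finset.Ico n (2 * n), partialSum g m x

theorem continuous_valleePoussin (n : ℕ) (g : ℝ → ℂ) : Continuous (valleePoussin n g) := by
  unfold valleePoussin
  have := continuous_partialSum g
  fun_prop

theorem normL_sum_dirichlet (N : ℕ) :
    normL (fun x => ∑ m ∈ Finset.range N, dirichlet m x) = 2 * π * N := by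
  have h : ∀ x, ((‖∑ m ∈ Finset.range N, dirichlet m x‖ : ℝ) : ℂ) =
      ∑ m ∈ Finset.range N, dirichlet m x := by
    intro x
    rw [sum_range_dirichlet, Complex.norm_real, norm_pow, norm_norm]
  have hc := continuous_dirichlet
  have : ((normL (fun x => ∑ m ∈ Finset.range N, dirichlet m x) : ℝ) : ℂ) = 2 * π * N := by
    rw [normL, ← intervalIntegral.integral_ofReal]
    simp_rw [h]
    rw [intervalIntegral.integral_finsetSum fun m _ => (hc m).intervalIntegrable _ _]
    simp_rw [integral_dirichlet]
    simp
    ring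
  exact_mod_cast this

/-- The sum is a difference of two Fejér sums, of norms `4πn` and `2πn`. -/
theorem normL_sum_Ico_dirichlet_le (n : ℕ) :
    normL (fun x => ∑ m ∈ Finset.Ico n (2 * n), dirichlet m x) ≤ 6 * π * n := by
  have hc := continuous_dirichlet
  have hi : ∀ N, IntervalIntegrable (fun x => ∑ m ∈ Finset.range N, dirichlet m x) volume (-π) π :=
    fun N => Continuous.intervalIntegrable (by fun_prop) _ _
  have h := normL_sub_le (hi (2 * n)) (g := fun _ => 0)
    (Continuous.intervalIntegrable (by fun_prop) _ _) (hi n)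
  rw [normL_sub_comm (fun _ => 0)] at h
  simp only [sub_zero, normL_sum_dirichlet] at h
  simp_rw [Finset.sum_Ico_eq_sub _ (by omega : n ≤ 2 * n)]
  refine h.trans (le_of_eq ?_)
  push_cast
  ring

theorem normL_valleePoussin_le {g : ℝ → ℂ} (hg : IntervalIntegrable g volume (-π) π) {n : ℕ}
    (hn : 0 < n) : normL (valleePoussin n g) ≤ 3 * normL g := by
  have hc := continuous_dirichlet
  have h : valleePoussin n g = fun x => (2 * π * n : ℂ)⁻¹ *
      ∫ t in (-π)..π, g t * ∑ m ∈ Finset.Ico n (2 * n), dirichlet m (x - t) := by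
    ext x
    simp_rw [valleePoussin, partialSum_eq_integral hg, ← Finset.mul_sum]
    rw [← intervalIntegral.integral_finsetSum fun m _ => hg.mul_continuousOn (by fun_prop)]
    simp_rw [Finset.mul_sum]
    rw [mul_inv]
    ring
  have hc := normL_convolution_le hg
    (by fun_prop : Continuous fun x => ∑ m ∈ Finset.Ico n (2 * n), dirichlet m x)
    (fun x => Finset.sum_congr rfl fun m _ => dirichlet_periodic m x)
  have hn' : (0 : ℝ) < n := by exact_mod_cast hn
  have hp := Real.pi_pos
  rw [h]
  calc _ = (2 * π * n)⁻¹ * normL (fun x =>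
        ∫ t in (-π)..π, g t * ∑ m ∈ Finset.Ico n (2 * n), dirichlet m (x - t)) := by
        rw [normL, normL, ← intervalIntegral.integral_const_mul]
        simp [abs_of_pos hp]
    _ ≤ (2 * π * n)⁻¹ * (normL g * (6 * π * n)) := by
        gcongr
        exact hc.trans (mul_le_mul_of_nonneg_left (normL_sum_Ico_dirichlet_le n) (normL_nonneg g))
    _ = 3 * normL g := by
        field_simp
        ring

/-! ### Density of trigonometric polynomials and convergence of the means. -/

theorem partialSum_add {f g : ℝ → ℂ} (hf : IntervalIntegrable f volume (-π) π)
    (hg : IntervalIntegrable g volume (-π) π) (n : ℕ) (x : ℝ) :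
    partialSum (fun x => f x + g x) n x = partialSum f n x + partialSum g n x := by
  simp_rw [partialSum, ← Finset.sum_add_distrib, ← add_mul]
  refine Finset.sum_congr rfl fun k _ => ?_
  rw [coeff_eq, coeff_eq, coeff_eq, ← mul_add, ← intervalIntegral.integral_add
    (intervalIntegrable_mul_exp hf k) (intervalIntegrable_mul_exp hg k)]
  simp_rw [add_mul]

theorem partialSum_const_mul (c : ℂ) (f : ℝ → ℂ) (n : ℕ) (x : ℝ) :
    partialSum (fun x => c * f x) n x = c * partialSum f n x := by
  simp_rw [partialSum, Finset.mul_sum]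
  refine Finset.sum_congr rfl fun k _ => ?_
  rw [coeff_eq, coeff_eq]
  simp_rw [mul_assoc]
  rw [intervalIntegral.integral_const_mul]
  ring

theorem coeff_exp (k j : ℤ) :
    coeff (fun x => Complex.exp (Complex.I * k * x)) j = if k = j then 1 else 0 := by
  rw [coeff_eq]
  have h : ∀ x : ℝ, Complex.exp (Complex.I * k * x) * Complex.exp (-(Complex.I * j * x)) =
      Complex.exp (Complex.I * ((k - j : ℤ) : ℂ) * x) := by
    intro x
    rw [← Complex.exp_add]
    push_cast
    ring_nf
  simp_rw [h, integral_exp_int, sub_eq_zero]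
  split_ifs
  · exact inv_mul_cancel₀ (by exact_mod_cast Real.two_pi_pos.ne')
  · simp

theorem partialSum_exp {k : ℤ} {n : ℕ} (h : k.natAbs ≤ n) (x : ℝ) :
    partialSum (fun x => Complex.exp (Complex.I * k * x)) n x =
      Complex.exp (Complex.I * k * x) := by
  simp_rw [partialSum, coeff_exp]
  simp only [ite_mul, one_mul, zero_mul, Finset.sum_ite_eq, Finset.mem_Icc]
  rw [if_pos (by omega)]

/-- Trigonometric polynomials, reproduced by all their late partial sums, are dense in `L_{2π}`. -/
theorem exists_normL_sub_lt {f : ℝ → ℂ} (hf : IntervalIntegrable f volume (-π) π) {ε : ℝ}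
    (hε : 0 < ε) : ∃ T : ℝ → ℂ, Continuous T ∧ (∃ N, ∀ n ≥ N, ∀ x, partialSum T n x = T x) ∧
      normL (fun x => f x - T x) < ε := by
  have hT : Fact (0 < 2 * π) := ⟨Real.two_pi_pos⟩
  have hp := Real.pi_pos
  have hpp : -π + 2 * π = π := by ring
  set F := AddCircle.liftIoc (2 * π) (-π) f with hF
  have hFv : MemLp F 1 := by
    refine MemLp.memLp_liftIoc ?_
    rwa [hpp, memLp_one_iff_integrable, ← IntegrableOn,
      ← intervalIntegrable_iff_integrableOn_Ioc_of_le neg_pi_le_pi]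
  have hFh : MemLp F 1 AddCircle.haarAddCircle := hFv.haarAddCircle
  have hden : hFh.toLp F ∈ (Submodule.span ℂ (Set.range (@fourierLp (2 * π) _ 1 _))).topologicalClosure := by
    rw [span_fourierLp_closure_eq_top (by simp)]
    trivial
  rw [← SetLike.mem_coe, Submodule.topologicalClosure_coe, Metric.mem_closure_iff] at hden
  -- Haar measure on the circle has total mass `1`, so distances there are `normL` divided by `2π`.
  obtain ⟨G, hG, hd⟩ := hden (ε / (2 * π)) (by positivity)
  have key : ∃ T : C(AddCircle (2 * π), ℂ), (∃ N, ∀ n ≥ N, ∀ x : ℝ,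
      partialSum (fun x => T x) n x = T x) ∧ G =ᵐ[AddCircle.haarAddCircle] T := by
    clear hd
    induction hG using Submodule.span_induction with
    | mem G h =>
      obtain ⟨k, rfl⟩ := h
      refine ⟨fourier k, ⟨k.natAbs, fun n hn x => ?_⟩, coeFn_fourierLp 1 k⟩
      have h : (fun x : ℝ => fourier k (x : AddCircle (2 * π))) =
          fun x : ℝ => Complex.exp (Complex.I * k * x) := by
        ext x
        rw [fourier_coe_apply]
        have : (π : ℂ) ≠ 0 := by exact_mod_cast hp.ne'
        congr 1
        push_cast
        field_simp
      rw [h, partialSum_exp hn]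
      exact (congrFun h x).symm
    | zero => exact ⟨0, ⟨0, fun n _ x => by simp [partialSum, coeff_eq]⟩, Lp.coeFn_zero _ _ _⟩
    | add G₁ G₂ _ _ h₁ h₂ =>
      obtain ⟨T₁, ⟨N₁, hN₁⟩, hT₁⟩ := h₁
      obtain ⟨T₂, ⟨N₂, hN₂⟩, hT₂⟩ := h₂
      refine ⟨T₁ + T₂, ⟨max N₁ N₂, fun n hn x => ?_⟩, ?_⟩
      · have hi : ∀ T : C(AddCircle (2 * π), ℂ),
            IntervalIntegrable (fun x : ℝ => T x) volume (-π) π := fun T =>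
          (T.continuous.comp (AddCircle.continuous_mk' _)).intervalIntegrable _ _
        simp only [ContinuousMap.add_apply]
        rw [partialSum_add (hi T₁) (hi T₂), hN₁ n (le_of_max_le_left hn),
          hN₂ n (le_of_max_le_right hn)]
      · filter_upwards [Lp.coeFn_add G₁ G₂, hT₁, hT₂] with x h h1 h2
        rw [h, Pi.add_apply, h1, h2, ContinuousMap.add_apply]
    | smul c G _ h =>
      obtain ⟨T, ⟨N, hN⟩, hT⟩ := h
      refine ⟨c • T, ⟨N, fun n hn x => ?_⟩, ?_⟩
      · simp only [ContinuousMap.smul_apply, smul_eq_mul]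
        rw [partialSum_const_mul, hN n hn]
      · filter_upwards [Lp.coeFn_smul c G, hT] with x h h1
        rw [h, Pi.smul_apply, h1, ContinuousMap.smul_apply]
  obtain ⟨T, hTN, hGT⟩ := key
  refine ⟨fun x => T x, T.continuous.comp (AddCircle.continuous_mk' _), hTN, ?_⟩
  have hdist : dist (hFh.toLp F) G = (2 * π)⁻¹ * normL (fun x => f x - T x) := by
    rw [dist_eq_norm, L1.norm_eq_integral_norm]
    have h1 : ∫ a, ‖(hFh.toLp F - G : Lp ℂ 1 AddCircle.haarAddCircle) a‖ ∂AddCircle.haarAddCircle =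
        ∫ a, ‖F a - T a‖ ∂AddCircle.haarAddCircle := by
      refine integral_congr_ae ?_
      filter_upwards [Lp.coeFn_sub (hFh.toLp F) G, hFh.coeFn_toLp, hGT] with x h h1 h2
      rw [h, Pi.sub_apply, h1, h2]
    rw [h1, AddCircle.integral_haarAddCircle, smul_eq_mul,
      ← AddCircle.intervalIntegral_preimage (2 * π) (-π), hpp, normL]
    congr 1
    rw [intervalIntegral.integral_of_le neg_pi_le_pi, intervalIntegral.integral_of_le neg_pi_le_pi]
    refine setIntegral_congr_fun measurableSet_Ioc fun x hx => ?_
    rw [hF, AddCircle.liftIoc_coe_apply (by rwa [hpp])]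
  rw [hdist, div_eq_inv_mul] at hd
  exact lt_of_mul_lt_mul_left hd (by positivity)

/-- For a polynomial `T` close to `f` and `n` large, `V_n T = T`, so `f - V_n f = (f - T) + V_n (T -
f)`, of norm at most `(1 + 3)` times that of `f - T`; hence the choice `ε / 4`. -/
theorem tendsto_normL_sub_valleePoussin {f : ℝ → ℂ} (hf : IntervalIntegrable f volume (-π) π) :
    Filter.Tendsto (fun n => normL (fun x => f x - valleePoussin n f x)) Filter.atTop (nhds 0) := by
  rw [Metric.tendsto_atTop]
  intro ε hε
  obtain ⟨T, hTc, ⟨N, hN⟩, hT⟩ := exists_normL_sub_lt hf (show 0 < ε / 4 by positivity)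
  refine ⟨max N 1, fun n hn => ?_⟩
  rw [Real.dist_0_eq_abs, abs_of_nonneg (normL_nonneg _)]
  have hn0 : 0 < n := lt_of_lt_of_le one_pos (le_of_max_le_right hn)
  have hTi := hTc.intervalIntegrable (μ := volume) (-π) π
  have hV := (continuous_valleePoussin n f).intervalIntegrable (μ := volume) (-π) π
  have hsub : (fun x => T x - valleePoussin n f x) = valleePoussin n (fun x => T x + -1 * f x) := by
    ext x
    have hVT : (n : ℂ)⁻¹ * ∑ m ∈ Finset.Ico n (2 * n), T x = T x := by
      have : (n : ℂ) ≠ 0 := by exact_mod_cast hn0.ne'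
      rw [Finset.sum_const, Nat.card_Ico, two_mul, Nat.add_sub_cancel, nsmul_eq_mul,
        inv_mul_cancel_left₀ this]
    simp_rw [valleePoussin, partialSum_add hTi (hf.const_mul (-1)), partialSum_const_mul]
    rw [Finset.sum_add_distrib, ← Finset.mul_sum, Finset.sum_congr rfl fun m hm =>
      hN m ((le_of_max_le_left hn).trans (Finset.mem_Ico.1 hm).1) x, mul_add, hVT]
    ring
  have h1 := normL_valleePoussin_le (hTi.add (hf.const_mul (-1))) hn0
  have h2 : normL (fun x => T x + -1 * f x) = normL (fun x => f x - T x) := by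
    rw [normL_sub_comm]
    simp [sub_eq_add_neg]
  have h3 := normL_sub_le hf hTi hV
  rw [hsub] at h3
  have h4 : normL (valleePoussin n (fun x => T x + -1 * f x)) ≤ 3 * normL (fun x => f x - T x) := by
    rw [← h2]
    exact h1
  linarith

/-! ### Pointwise bounds by Abel summation. -/

/-- The sum `A` has at most `n` terms of modulus `1`, and as a geometric sum it satisfies `‖A‖ * |x|
≤ π`. Adding the first bound to `n` times the second gives `‖A‖ * (1 + n|x|) ≤ n * (1 + π)`. -/
theorem norm_sum_exp_mul_le {n m : ℕ} (hnm : n ≤ m) (hm : m ≤ 2 * n) {x : ℝ} (hx : |x| ≤ π) :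
    ‖∑ k ∈ Finset.Ioc n m, Complex.exp (Complex.I * k * x)‖ ≤
      (1 + π) * (n / (1 + n * |x|)) := by
  have hp := Real.pi_pos
  have hn1 : ‖∑ k ∈ Finset.Ioc n m, Complex.exp (Complex.I * k * x)‖ ≤ n := by
    refine (norm_sum_le _ _).trans ?_
    have h : ∀ k : ℕ, ‖Complex.exp (Complex.I * k * x)‖ = 1 := by
      intro k
      rw [show Complex.I * (k : ℂ) * x = ((k * x : ℝ) : ℂ) * Complex.I by push_cast; ring,
        Complex.norm_exp_ofReal_mul_I]
    simp only [h, Finset.sum_const, Nat.card_Ioc, nsmul_eq_mul, mul_one, Nat.cast_le]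
    omega
  have hn2 : ‖∑ k ∈ Finset.Ioc n m, Complex.exp (Complex.I * k * x)‖ * |x| ≤ π := by
    set z := Complex.exp (Complex.I * x) with hz
    have hzk : ∀ k : ℕ, Complex.exp (Complex.I * k * x) = z ^ k := by
      intro k
      rw [hz, ← Complex.exp_nat_mul]
      ring_nf
    have hz1 : ‖z‖ = 1 := by rw [hz, mul_comm, Complex.norm_exp_ofReal_mul_I]
    have htel : (∑ k ∈ Finset.Ioc n m, z ^ k) * (z - 1) = z ^ (m + 1) - z ^ (n + 1) := by
      clear hn1 hm
      induction m, hnm using Nat.le_induction with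
      | base => simp
      | succ m h ih =>
        rw [← Finset.insert_Ioc_right_eq_Ioc_add_one h, Finset.sum_insert (by simp), add_mul, ih]
        ring
    have h2 : ‖(∑ k ∈ Finset.Ioc n m, z ^ k)‖ * ‖z - 1‖ ≤ 2 := by
      rw [← norm_mul, htel]
      refine (norm_sub_le _ _).trans ?_
      rw [norm_pow, norm_pow, hz1]
      norm_num
    -- `‖z - 1‖ = 2 |sin (x / 2)|`, and Jordan's inequality applies because `|x / 2| ≤ π / 2`.
    have h3 : 2 / π * |x| ≤ ‖z - 1‖ := by
      rw [hz, Complex.norm_exp_I_mul_ofReal_sub_one, norm_mul, Real.norm_eq_abs, Real.norm_eq_abs]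
      have h := Real.mul_abs_le_abs_sin (x := x / 2) (by rw [abs_div, abs_two]; linarith)
      rw [abs_div, abs_two] at h
      rw [abs_two]
      linarith
    simp_rw [hzk]
    have h4 := (mul_le_mul_of_nonneg_left h3 (norm_nonneg (∑ k ∈ Finset.Ioc n m, z ^ k))).trans h2
    rw [show ‖∑ k ∈ Finset.Ioc n m, z ^ k‖ * (2 / π * |x|) =
      2 * (‖∑ k ∈ Finset.Ioc n m, z ^ k‖ * |x|) / π by ring, div_le_iff₀ hp] at h4
    linarith
  rw [← mul_div_assoc, le_div_iff₀ (by positivity)]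
  nlinarith [mul_le_mul_of_nonneg_left hn2 (Nat.cast_nonneg (α := ℝ) n)]

theorem sum_Ioc_by_parts (c u : ℕ → ℂ) {n m : ℕ} (h : n ≤ m) :
    ∑ k ∈ Finset.Ioc n m, c k * u k = c m * ∑ k ∈ Finset.Ioc n m, u k +
      ∑ k ∈ Finset.Ico n m, (c k - c (k + 1)) * ∑ j ∈ Finset.Ioc n k, u j := by
  induction m, h using Nat.le_induction with
  | base => simp
  | succ m h ih =>
    rw [← Finset.insert_Ioc_right_eq_Ioc_add_one h, Finset.sum_insert (by simp),
      Finset.sum_insert (by simp), ih, Finset.sum_Ico_succ_top h]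
    ring

theorem norm_sub_le_sum_Ico (c : ℕ → ℂ) {n m : ℕ} (h : n ≤ m) :
    ‖c m - c n‖ ≤ ∑ k ∈ Finset.Ico n m, ‖c k - c (k + 1)‖ := by
  rw [← dist_eq_norm, dist_comm]
  simpa only [dist_eq_norm] using dist_le_Ico_sum_dist c h

/-- In the Abel sum the variation is paid for twice, once to compare `c m` with `c n` and once in
the difference terms; with `‖c n‖` itself this makes `2 * K + 1`. -/
theorem norm_sum_Ioc_mul_le {c u : ℕ → ℂ} {K H : ℝ} {n m : ℕ}
    (hK : ∑ k ∈ Finset.Icc n (2 * n), ‖c k - c (k + 1)‖ ≤ K * (‖c n‖ + ‖c (2 * n)‖))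
    (hnm : n ≤ m) (hm : m ≤ 2 * n)
    (hu : ∀ k, n ≤ k → k ≤ m → ‖∑ j ∈ Finset.Ioc n k, u j‖ ≤ H) :
    ‖∑ k ∈ Finset.Ioc n m, c k * u k‖ ≤ (2 * K + 1) * (‖c n‖ + ‖c (2 * n)‖) * H := by
  have hH : 0 ≤ H := (norm_nonneg _).trans (hu n le_rfl hnm)
  have h1 : ∑ k ∈ Finset.Ico n m, ‖c k - c (k + 1)‖ ≤ K * (‖c n‖ + ‖c (2 * n)‖) := by
    refine le_trans (Finset.sum_le_sum_of_subset_of_nonneg ?_ fun _ _ _ => norm_nonneg _) hK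
    intro k
    simp only [Finset.mem_Ico, Finset.mem_Icc]
    omega
  have h2 : ‖c m‖ ≤ ‖c n‖ + K * (‖c n‖ + ‖c (2 * n)‖) := by
    have := norm_sub_le_sum_Ico c hnm
    have h3 := norm_sub_norm_le (c m) (c n)
    linarith
  have h3 : ‖∑ k ∈ Finset.Ico n m, (c k - c (k + 1)) * ∑ j ∈ Finset.Ioc n k, u j‖ ≤
      (∑ k ∈ Finset.Ico n m, ‖c k - c (k + 1)‖) * H := by
    rw [Finset.sum_mul]
    refine norm_sum_le_of_le _ fun k hk => ?_
    rw [norm_mul]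
    have hk' := Finset.mem_Ico.1 hk
    exact mul_le_mul_of_nonneg_left (hu k hk'.1 hk'.2.le) (norm_nonneg _)
  rw [sum_Ioc_by_parts c u hnm]
  calc _ ≤ ‖c m‖ * H + (∑ k ∈ Finset.Ico n m, ‖c k - c (k + 1)‖) * H := by
        refine (norm_add_le _ _).trans (add_le_add ?_ h3)
        rw [norm_mul]
        exact mul_le_mul_of_nonneg_left (hu m hnm le_rfl) (norm_nonneg _)
    _ = (‖c m‖ + ∑ k ∈ Finset.Ico n m, ‖c k - c (k + 1)‖) * H := by ring
    _ ≤ _ := by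
        gcongr
        linarith [norm_nonneg (c (2 * n))]

/-- Since `f` is real, the negative frequencies contribute the conjugate of the positive ones: this
is the leading factor `2`, and only nonnegative indices need a variation bound. -/
theorem norm_partialSum_sub_partialSum_le {f : ℝ → ℝ} {K : ℝ} {n m : ℕ}
    (hK : ∑ k ∈ Finset.Icc n (2 * n), ‖coeff (fun x => (f x : ℂ)) (k : ℕ) -
      coeff (fun x => (f x : ℂ)) (k + 1 : ℕ)‖ ≤
        K * (‖coeff (fun x => (f x : ℂ)) n‖ + ‖coeff (fun x => (f x : ℂ)) (2 * n : ℕ)‖))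
    (hnm : n ≤ m) (hm : m ≤ 2 * n) {x : ℝ} (hx : |x| ≤ π) :
    ‖partialSum (fun x => (f x : ℂ)) m x - partialSum (fun x => (f x : ℂ)) n x‖ ≤
      2 * (2 * K + 1) * (1 + π) * (‖coeff (fun x => (f x : ℂ)) n‖ +
        ‖coeff (fun x => (f x : ℂ)) (2 * n : ℕ)‖) * (n / (1 + n * |x|)) := by
  have hconj : ∀ k : ℕ, coeff (fun x => (f x : ℂ)) (-k) * Complex.exp (-(Complex.I * k * x)) =
      conj (coeff (fun x => (f x : ℂ)) k * Complex.exp (Complex.I * k * x)) := by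
    intro k
    rw [map_mul, coeff_neg_of_real, ← Complex.exp_conj]
    simp
  rw [partialSum_sub_partialSum _ hnm]
  simp_rw [hconj]
  rw [Finset.sum_add_distrib, ← map_sum]
  have h := norm_sum_Ioc_mul_le (c := fun k : ℕ => coeff (fun x => (f x : ℂ)) k)
    (u := fun k : ℕ => Complex.exp (Complex.I * k * x)) hK hnm hm
    fun k h1 h2 => norm_sum_exp_mul_le h1 (h2.trans hm) hx
  refine (norm_add_le _ _).trans ?_
  rw [RCLike.norm_conj]
  linarith

/-! ### Sufficiency of the logarithmic condition. -/

theorem continuous_div_one_add_mul_abs (n : ℕ) :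
    Continuous fun x : ℝ => (n : ℝ) / (1 + n * |x|) :=
  continuous_const.div (by fun_prop) fun x => by positivity

theorem integral_div_one_add_mul_abs (n : ℕ) :
    ∫ x in (-π)..π, (n : ℝ) / (1 + n * |x|) = 2 * Real.log (1 + n * π) := by
  have hc := continuous_div_one_add_mul_abs n
  have h1 : ∫ x in (0)..π, (n : ℝ) / (1 + n * |x|) = Real.log (1 + n * π) := by
    have hpos : ∀ x ∈ Set.uIcc 0 π, 0 ≤ x := fun x hx => by
      rw [Set.uIcc_of_le Real.pi_pos.le] at hx
      exact hx.1
    have hd : ∀ x ∈ Set.uIcc 0 π, HasDerivAt (fun x : ℝ => Real.log (1 + n * x))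
        ((n : ℝ) / (1 + n * |x|)) x := by
      intro x hx
      have hx0 := hpos x hx
      rw [abs_of_nonneg hx0]
      have h := (((hasDerivAt_id x).const_mul (n : ℝ)).const_add 1).log
        (by simp only [id]; positivity)
      simpa using h
    rw [intervalIntegral.integral_eq_sub_of_hasDerivAt hd (hc.intervalIntegrable _ _)]
    simp
  have h2 : ∫ x in (-π)..0, (n : ℝ) / (1 + n * |x|) = Real.log (1 + n * π) := by
    rw [← h1, ← neg_zero, ← intervalIntegral.integral_comp_neg]
    simp
  rw [← intervalIntegral.integral_add_adjacent_intervals (hc.intervalIntegrable (-π) 0)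
    (hc.intervalIntegrable 0 π), h1, h2]
  ring

theorem log_one_add_mul_pi_le {n : ℕ} (hn : 2 ≤ n) : Real.log (1 + n * π) ≤ 4 * Real.log n := by
  have hn' : (2 : ℝ) ≤ n := by exact_mod_cast hn
  have hp := Real.pi_pos
  rw [← Real.log_rpow (by positivity)]
  refine Real.log_le_log (by positivity) ?_
  -- The chain is `1 + nπ ≤ 1 + 4n ≤ 8n ≤ n ^ 4`.
  have h8 : (8 : ℝ) ≤ n ^ 3 := by
    have := pow_le_pow_left₀ (by norm_num) hn' 3
    norm_num at this
    exact this
  have h4 : (n : ℝ) ^ (4 : ℝ) = n * n ^ 3 := by norm_cast; ring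
  rw [h4]
  nlinarith [Real.pi_le_four]

theorem tendsto_normL_sub_partialSum {f : ℝ → ℝ} {K : ℝ} (hK0 : 0 < K)
    (hf : IntervalIntegrable (fun x => (f x : ℂ)) volume (-π) π)
    (hK : ∀ n : ℕ, 1 ≤ n → ∑ k ∈ Finset.Icc n (2 * n), ‖coeff (fun x => (f x : ℂ)) (k : ℕ) -
      coeff (fun x => (f x : ℂ)) (k + 1 : ℕ)‖ ≤
        K * (‖coeff (fun x => (f x : ℂ)) n‖ + ‖coeff (fun x => (f x : ℂ)) (2 * n : ℕ)‖))
    (hlog : Tendsto (fun n : ℕ => ‖coeff (fun x => (f x : ℂ)) n‖ * Real.log n) atTop (𝓝 0)) :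
    Tendsto (fun n : ℕ => normL (fun x => (f x : ℂ) - partialSum (fun y => (f y : ℂ)) n x))
      atTop (𝓝 0) := by
  set F : ℝ → ℂ := fun x => (f x : ℂ) with hF
  have hp := Real.pi_pos
  set C := 2 * (2 * K + 1) * (1 + π) with hC
  have hC0 : 0 ≤ C := by positivity
  have hlog2 : Tendsto (fun n : ℕ => ‖coeff F (2 * n : ℕ)‖ * Real.log (2 * n : ℕ)) atTop (𝓝 0) :=
    hlog.comp (tendsto_id.const_mul_atTop' two_pos)
  have hlim := (tendsto_normL_sub_valleePoussin hf).add ((hlog.add hlog2).const_mul (C * 8))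
  rw [add_zero, mul_zero, add_zero] at hlim
  refine tendsto_of_tendsto_of_tendsto_of_le_of_le' tendsto_const_nhds hlim
    (.of_forall fun n => normL_nonneg _) ?_
  filter_upwards [eventually_ge_atTop 2] with n hn
  have hn0 : (n : ℂ) ≠ 0 := by
    have : n ≠ 0 := by omega
    exact_mod_cast this
  have hnpos : (0 : ℝ) < n := by
    have : 0 < n := by omega
    exact_mod_cast this
  have hVi := (continuous_valleePoussin n F).intervalIntegrable (μ := volume) (-π) π
  have hSi := intervalIntegrable_partialSum F n (-π) π
  refine (normL_sub_le hf hVi hSi).trans (add_le_add le_rfl ?_)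
  have hpt : ∀ x ∈ Set.Icc (-π) π, ‖valleePoussin n F x - partialSum F n x‖ ≤
      C * (‖coeff F n‖ + ‖coeff F (2 * n : ℕ)‖) * (n / (1 + n * |x|)) := by
    intro x hx
    have hV : valleePoussin n F x - partialSum F n x =
        (n : ℂ)⁻¹ * ∑ m ∈ Finset.Ico n (2 * n), (partialSum F m x - partialSum F n x) := by
      rw [Finset.sum_sub_distrib, Finset.sum_const, Nat.card_Ico, two_mul, Nat.add_sub_cancel,
        nsmul_eq_mul, mul_sub, inv_mul_cancel_left₀ hn0, valleePoussin, two_mul]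
    have hs : ‖∑ m ∈ Finset.Ico n (2 * n), (partialSum F m x - partialSum F n x)‖ ≤
        n * (C * (‖coeff F n‖ + ‖coeff F (2 * n : ℕ)‖) * (n / (1 + n * |x|))) := by
      refine (norm_sum_le_of_le _ fun m hm => norm_partialSum_sub_partialSum_le
        (hK n (by omega)) (Finset.mem_Ico.1 hm).1 (Finset.mem_Ico.1 hm).2.le (abs_le.2 hx)).trans ?_
      rw [Finset.sum_const, Nat.card_Ico, two_mul n, Nat.add_sub_cancel, nsmul_eq_mul]
    rw [hV, norm_mul, norm_inv, Complex.norm_natCast, inv_mul_le_iff₀ hnpos]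
    exact hs
  have hci : IntervalIntegrable (fun x : ℝ => C * (‖coeff F n‖ + ‖coeff F (2 * n : ℕ)‖) *
      (n / (1 + n * |x|))) volume (-π) π :=
    ((continuous_div_one_add_mul_abs n).intervalIntegrable _ _).const_mul _
  refine (normL_le (hVi.sub hSi) hci hpt).trans ?_
  rw [intervalIntegral.integral_const_mul, integral_div_one_add_mul_abs]
  have hl := log_one_add_mul_pi_le hn
  -- Matches `‖c (2n)‖` with the logarithm of its own index, so that the hypothesis along even
  -- indices applies.
  have hl2 : Real.log n ≤ Real.log (2 * n : ℕ) := by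
    refine Real.log_le_log hnpos ?_
    push_cast
    linarith
  calc _ ≤ C * (‖coeff F n‖ + ‖coeff F (2 * n : ℕ)‖) * (2 * (4 * Real.log n)) := by gcongr
    _ = C * 8 * (‖coeff F n‖ * Real.log n + ‖coeff F (2 * n : ℕ)‖ * Real.log n) := by ring
    _ ≤ _ := by gcongr

/-! ### Necessity of the logarithmic condition. -/

/-- The test function has modulus `x ≤ 2π`. The period is moved to `[0, 2π]`, where the sawtooth is
simply `x`. -/
theorem norm_integral_mul_sawtooth_le {P : ℝ → ℂ} (hP : Continuous P)
    (hper : Function.Periodic P (2 * π)) (n : ℕ) :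
    ‖∫ x in (0)..(2 * π), P x * (x * Complex.exp (-(Complex.I * (n : ℤ) * x)))‖ ≤
      2 * π * normL P := by
  have hp := Real.two_pi_pos
  have hshift : normL P = ∫ x in (0)..(2 * π), ‖P x‖ := by
    have := (hper.comp norm).intervalIntegral_add_eq (-π) 0
    simp only [Function.comp_def] at this
    rw [normL]
    convert this using 2 <;> ring
  rw [hshift, ← intervalIntegral.integral_const_mul]
  refine intervalIntegral.norm_integral_le_of_norm_le hp.le (.of_forall fun x hx => ?_)
    (Continuous.intervalIntegrable (by fun_prop) _ _)
  rw [show -(Complex.I * ((n : ℤ) : ℂ) * x) = ((-(n * x) : ℝ) : ℂ) * Complex.I by push_cast; ring,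
    norm_mul, norm_mul, Complex.norm_exp_ofReal_mul_I, mul_one, Complex.norm_real,
    Real.norm_of_nonneg hx.1.le, mul_comm]
  exact mul_le_mul_of_nonneg_right hx.2 (norm_nonneg _)

/-- Testing against `x e^{-inx}` turns `e^{ikx}` and `e^{-ikx}` into `2π / (i(k - n))` and `-2π /
(i(k + n))`. The common factor `2π / i` cancels the `2π` of the sawtooth bound. -/
theorem norm_sum_coeff_div_le (f : ℝ → ℂ) (n : ℕ) :
    ‖∑ k ∈ Finset.Ioc n (2 * n), (coeff f k / (k - n) - coeff f (-k) / (k + n))‖ ≤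
      normL (fun x => partialSum f (2 * n) x - partialSum f n x) := by
  have hp := Real.two_pi_pos
  have hper : ∀ m, Function.Periodic (partialSum f m) (2 * π) := fun m x =>
    Finset.sum_congr rfl fun k _ => congrArg (coeff f k * ·) (exp_int_periodic k x)
  have hcont := continuous_partialSum f
  have h := norm_integral_mul_sawtooth_le (P := fun x => partialSum f (2 * n) x - partialSum f n x)
    (by fun_prop) ((hper _).sub (hper _)) n
  have hterm : ∀ k ∈ Finset.Ioc n (2 * n), ∫ x : ℝ in (0)..(2 * π),
      (coeff f k * Complex.exp (Complex.I * k * x) + coeff f (-k) *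
        Complex.exp (-(Complex.I * k * x))) * (x * Complex.exp (-(Complex.I * (n : ℤ) * x))) =
      (2 * π / Complex.I) * (coeff f k / (k - n) - coeff f (-k) / (k + n)) := by
    intro k hk
    have hk' := Finset.mem_Ioc.1 hk
    have e : ∀ x : ℝ, (coeff f k * Complex.exp (Complex.I * k * x) + coeff f (-k) *
        Complex.exp (-(Complex.I * k * x))) * (x * Complex.exp (-(Complex.I * (n : ℤ) * x))) =
        coeff f k * (x * Complex.exp (Complex.I * ((k - n : ℤ) : ℂ) * x)) +
        coeff f (-k) * (x * Complex.exp (Complex.I * ((-k - n : ℤ) : ℂ) * x)) := by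
      intro x
      rw [show Complex.I * ((k - n : ℤ) : ℂ) * x = Complex.I * k * x + -(Complex.I * (n : ℤ) * x) by
        push_cast; ring, show Complex.I * ((-k - n : ℤ) : ℂ) * x =
          -(Complex.I * k * x) + -(Complex.I * (n : ℤ) * x) by push_cast; ring,
        Complex.exp_add, Complex.exp_add]
      ring
    simp_rw [e]
    rw [intervalIntegral.integral_add (Continuous.intervalIntegrable (by fun_prop) _ _)
      (Continuous.intervalIntegrable (by fun_prop) _ _), intervalIntegral.integral_const_mul,
      intervalIntegral.integral_const_mul, integral_mul_exp_int (by omega),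
      integral_mul_exp_int (by omega)]
    have h1 : (k : ℂ) - n ≠ 0 := sub_ne_zero.2 (by exact_mod_cast (by omega : k ≠ n))
    have h2 : (k : ℂ) + n ≠ 0 := by exact_mod_cast (by omega : k + n ≠ 0)
    have h3 : -(k : ℂ) - n ≠ 0 := by
      rw [← neg_add']
      exact neg_ne_zero.2 h2
    push_cast
    rw [← neg_add']
    field_simp
    ring
  have hsum : ∫ x in (0)..(2 * π), (partialSum f (2 * n) x - partialSum f n x) *
      (x * Complex.exp (-(Complex.I * (n : ℤ) * x))) = (2 * π / Complex.I) *
      ∑ k ∈ Finset.Ioc n (2 * n), (coeff f k / (k - n) - coeff f (-k) / (k + n)) := by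
    simp_rw [partialSum_sub_partialSum f (by omega : n ≤ 2 * n), Finset.sum_mul]
    rw [intervalIntegral.integral_finsetSum
      fun k _ => Continuous.intervalIntegrable (by fun_prop) _ _, Finset.mul_sum]
    exact Finset.sum_congr rfl hterm
  rw [hsum, norm_mul] at h
  have h2 : ‖(2 * π / Complex.I : ℂ)‖ = 2 * π := by simp [abs_of_pos Real.pi_pos]
  rw [h2] at h
  exact le_of_mul_le_mul_left h hp

/-- As `θ < π / 2`, `cos θ` is positive, so in the sector the real part controls the modulus and no
cancellation occurs in sums. -/
theorem mul_cos_le_re_of_mem_sector {θ : ℝ} (hθ : θ ∈ Set.Ico 0 (π / 2)) {z : ℂ}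
    (hz : z ∈ sector θ) : ‖z‖ * Real.cos θ ≤ z.re := by
  rw [← Complex.norm_mul_cos_arg z, ← Real.cos_abs z.arg]
  refine mul_le_mul_of_nonneg_left (Real.cos_le_cos_of_nonneg_of_le_pi (abs_nonneg _) ?_ hz)
    (norm_nonneg _)
  linarith [hθ.2, Real.pi_pos]

theorem sum_norm_coeff_div_le {f : ℝ → ℝ} {θ : ℝ} (hθ : θ ∈ Set.Ico 0 (π / 2))
    (hs : ∀ n : ℕ, 1 ≤ n → coeff (fun x => (f x : ℂ)) n ∈ sector θ) (n : ℕ) :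
    2 / 3 * Real.cos θ * ∑ k ∈ Finset.Ioc n (2 * n), ‖coeff (fun x => (f x : ℂ)) k‖ / (k - n) ≤
      normL (fun x => partialSum (fun x => (f x : ℂ)) (2 * n) x -
        partialSum (fun x => (f x : ℂ)) n x) := by
  refine le_trans ?_ ((Complex.re_le_norm _).trans (norm_sum_coeff_div_le _ n))
  rw [Complex.re_sum, Finset.mul_sum]
  refine Finset.sum_le_sum fun k hk => ?_
  have hk' := Finset.mem_Ioc.1 hk
  have h1 : (n : ℝ) < k := by exact_mod_cast hk'.1
  have h2 : (k : ℝ) ≤ 2 * n := by exact_mod_cast hk'.2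
  have hre := mul_cos_le_re_of_mem_sector hθ (hs k (by omega))
  have hcos : 0 ≤ Real.cos θ :=
    Real.cos_nonneg_of_neg_pi_div_two_le_of_le (by linarith [hθ.1, Real.pi_pos]) hθ.2.le
  rw [coeff_neg_of_real]
  set c := coeff (fun x => (f x : ℂ)) k
  have e : (c / (k - n) - conj c / (k + n)).re = c.re / (k - n) - c.re / (k + n) := by
    rw [show (k : ℂ) - n = ((k - n : ℝ) : ℂ) by push_cast; rfl,
      show (k : ℂ) + n = ((k + n : ℝ) : ℂ) by push_cast; rfl, Complex.sub_re,
      Complex.div_ofReal_re, Complex.div_ofReal_re, Complex.conj_re]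
  rw [e]
  have hre0 : 0 ≤ c.re := le_trans (by positivity) hre
  -- `k ≤ 2n` means `k + n ≥ 3(k - n)`, so the conjugate term removes at most a third; this is the
  -- source of `2 / 3`.
  have h3 : c.re / (k + n) ≤ c.re / (3 * (k - n)) :=
    div_le_div_of_nonneg_left hre0 (by linarith) (by linarith)
  have h4 : ‖c‖ * Real.cos θ / (k - n) ≤ c.re / (k - n) :=
    div_le_div_of_nonneg_right hre (by linarith)
  have h5 : c.re / (3 * (k - n)) = 1 / 3 * (c.re / (k - n)) := by
    have : (k : ℝ) - n ≠ 0 := by linarith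
    field_simp
  have h6 : 2 / 3 * Real.cos θ * (‖c‖ / (k - n)) = 2 / 3 * (‖c‖ * Real.cos θ / (k - n)) := by ring
  linarith

theorem log_add_one_le_sum_Ioc (n m : ℕ) :
    Real.log (m + 1) ≤ ∑ k ∈ Finset.Ioc n (n + m), 1 / ((k : ℝ) - n) := by
  induction m with
  | zero => simp
  | succ m ih =>
    rw [← add_assoc, ← Finset.insert_Ioc_right_eq_Ioc_add_one (by omega),
      Finset.sum_insert (by simp)]
    have h := Real.log_le_sub_one_of_pos (x := ((m : ℝ) + 1 + 1) / (m + 1)) (by positivity)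
    rw [Real.log_div (by positivity) (by positivity)] at h
    have h2 : ((m : ℝ) + 1 + 1) / (m + 1) - 1 = 1 / (m + 1) := by field_simp; ring
    push_cast
    rw [show (n : ℝ) + m + 1 - n = m + 1 by ring]
    linarith

/-- A bound for the single term `c N` by each pair `c k`, `c (2k)` is summed with the weights `1 /
(k - n)`, whose harmonic total produces the logarithm. -/
theorem norm_mul_log_le {c : ℕ → ℂ} {K : ℝ} (hK0 : 0 < K)
    (hK : ∀ m : ℕ, 1 ≤ m →
      ∑ n ∈ Finset.Icc m (2 * m), ‖c n - c (n + 1)‖ ≤ K * (‖c m‖ + ‖c (2 * m)‖))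
    {N : ℕ} (hN : 1 ≤ N) :
    ‖c N‖ * Real.log N ≤ 2 * (K + 1) *
      (∑ k ∈ Finset.Ioc (N / 2) (2 * (N / 2)), ‖c k‖ / (k - (N / 2 : ℕ)) +
        2 * ∑ k ∈ Finset.Ioc (2 * (N / 2)) (2 * (2 * (N / 2))),
          ‖c k‖ / (k - (2 * (N / 2) : ℕ))) := by
  set n := N / 2 with hn
  have hlog : Real.log N ≤ 2 * Real.log (n + 1) := by
    have : Real.log (((n : ℝ) + 1) ^ 2) = 2 * Real.log (n + 1) := by
      rw [Real.log_pow]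
      norm_num
    rw [← this]
    refine Real.log_le_log (by exact_mod_cast hN) ?_
    -- Rounding down costs at most one: `N ≤ 2n + 1 ≤ (n + 1) ^ 2`.
    have h : N ≤ (n + 1) ^ 2 := by
      have : N ≤ 2 * n + 1 := by omega
      nlinarith
    exact_mod_cast h
  -- Here `k ≤ 2n ≤ N < 2k`, so passing from `c k` to `c N` stays inside one NBVS block.
  have hc : ∀ k ∈ Finset.Ioc n (2 * n), ‖c N‖ ≤ (K + 1) * (‖c k‖ + ‖c (2 * k)‖) := by
    intro k hk
    have hk' := Finset.mem_Ioc.1 hk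
    have h1 := norm_sub_le_sum_Ico c (by omega : k ≤ N)
    have h2 : ∑ j ∈ Finset.Ico k N, ‖c j - c (j + 1)‖ ≤
        ∑ j ∈ Finset.Icc k (2 * k), ‖c j - c (j + 1)‖ := by
      refine Finset.sum_le_sum_of_subset_of_nonneg ?_ fun _ _ _ => norm_nonneg _
      intro j
      simp only [Finset.mem_Ico, Finset.mem_Icc]
      omega
    have h3 := hK k (by omega)
    have h4 := norm_sub_norm_le (c N) (c k)
    linarith [norm_nonneg (c (2 * k))]
  -- With `l = 2k`, `1 / (k - n) = 2 / (l - 2n)`; the sum over even `l` is then enlarged to all `l`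
  -- in the next dyadic block.
  have hdouble : ∑ k ∈ Finset.Ioc n (2 * n), ‖c (2 * k)‖ / (k - n) ≤
      2 * ∑ k ∈ Finset.Ioc (2 * n) (2 * (2 * n)), ‖c k‖ / (k - (2 * n : ℕ)) := by
    have h1 : ∑ k ∈ Finset.Ioc n (2 * n), ‖c (2 * k)‖ / ((k : ℝ) - n) =
        2 * ∑ l ∈ (Finset.Ioc n (2 * n)).image (2 * ·), ‖c l‖ / ((l : ℝ) - (2 * n : ℕ)) := by
      rw [Finset.sum_image (by intro a _ b _ h; simpa using h), Finset.mul_sum]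
      refine Finset.sum_congr rfl fun k hk => ?_
      have : (n : ℝ) < k := by exact_mod_cast (Finset.mem_Ioc.1 hk).1
      have h0 : (k : ℝ) - n ≠ 0 := by linarith
      push_cast
      rw [← mul_sub]
      field_simp
    rw [h1]
    refine mul_le_mul_of_nonneg_left (Finset.sum_le_sum_of_subset_of_nonneg ?_ ?_) two_pos.le
    · intro l
      simp only [Finset.mem_image, Finset.mem_Ioc]
      rintro ⟨k, hk, rfl⟩
      omega
    · intro l hl _
      have : ((2 * n : ℕ) : ℝ) < l := by exact_mod_cast (Finset.mem_Ioc.1 hl).1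
      exact div_nonneg (norm_nonneg _) (by linarith)
  have hsum : ‖c N‖ * Real.log (n + 1) ≤ (K + 1) *
      (∑ k ∈ Finset.Ioc n (2 * n), ‖c k‖ / ((k : ℝ) - n) +
        ∑ k ∈ Finset.Ioc n (2 * n), ‖c (2 * k)‖ / ((k : ℝ) - n)) := by
    refine (mul_le_mul_of_nonneg_left (log_add_one_le_sum_Ioc n n) (norm_nonneg _)).trans ?_
    rw [← two_mul, ← Finset.sum_add_distrib, Finset.mul_sum, Finset.mul_sum]
    refine Finset.sum_le_sum fun k hk => ?_
    have : (n : ℝ) < k := by exact_mod_cast (Finset.mem_Ioc.1 hk).1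
    rw [← add_div, ← mul_div_assoc, ← mul_div_assoc, mul_one]
    exact div_le_div_of_nonneg_right (hc k hk) (by linarith)
  have hA := mul_le_mul_of_nonneg_left hlog (norm_nonneg (c N))
  have hB := mul_le_mul_of_nonneg_left hdouble (by linarith : 0 ≤ K + 1)
  linarith

theorem tendsto_coeff_mul_log {f : ℝ → ℝ} {K θ : ℝ} (hK0 : 0 < K)
    (hf : IntervalIntegrable (fun x => (f x : ℂ)) volume (-π) π)
    (hθ : θ ∈ Set.Ico 0 (π / 2))
    (hs : ∀ n : ℕ, 1 ≤ n → coeff (fun x => (f x : ℂ)) n ∈ sector θ)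
    (hK : ∀ n : ℕ, 1 ≤ n → ∑ k ∈ Finset.Icc n (2 * n), ‖coeff (fun x => (f x : ℂ)) (k : ℕ) -
      coeff (fun x => (f x : ℂ)) (k + 1 : ℕ)‖ ≤
        K * (‖coeff (fun x => (f x : ℂ)) n‖ + ‖coeff (fun x => (f x : ℂ)) (2 * n : ℕ)‖))
    (hlim : Tendsto (fun n : ℕ => normL (fun x => (f x : ℂ) -
      partialSum (fun y => (f y : ℂ)) n x)) atTop (𝓝 0)) :
    Tendsto (fun n : ℕ => ‖coeff (fun x => (f x : ℂ)) n‖ * Real.log n) atTop (𝓝 0) := by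
  set F : ℝ → ℂ := fun x => (f x : ℂ) with hF
  have hcos : 0 < Real.cos θ :=
    Real.cos_pos_of_mem_Ioo ⟨by linarith [hθ.1, Real.pi_pos], hθ.2⟩
  have hdouble : Tendsto (fun n : ℕ => 2 * n) atTop atTop := tendsto_id.const_mul_atTop' two_pos
  set A : ℕ → ℝ := fun n => ∑ k ∈ Finset.Ioc n (2 * n), ‖coeff F k‖ / ((k : ℝ) - n) with hA
  have hA0 : ∀ n, 0 ≤ A n := fun n => Finset.sum_nonneg fun k hk => by
    have : (n : ℝ) < k := by exact_mod_cast (Finset.mem_Ioc.1 hk).1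
    exact div_nonneg (norm_nonneg _) (by linarith)
  have hAlim : Tendsto A atTop (𝓝 0) := by
    -- `S_{2n} f - S_n f` is within the sum of the two errors `f - S_{2n} f` and `f - S_n f`.
    have h := ((hlim.comp hdouble).add hlim).const_mul (2 / 3 * Real.cos θ)⁻¹
    rw [add_zero, mul_zero] at h
    refine squeeze_zero hA0 (fun n => ?_) h
    rw [le_inv_mul_iff₀ (by positivity)]
    refine (sum_norm_coeff_div_le hθ hs n).trans ?_
    have hi := fun m => intervalIntegrable_partialSum F m (-π) π
    have := normL_sub_le (hi (2 * n)) hf (hi n)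
    rwa [normL_sub_comm (partialSum F (2 * n)) F] at this
  have hhalf : Tendsto (fun N : ℕ => N / 2) atTop atTop := Nat.tendsto_div_const_atTop two_ne_zero
  have h := ((hAlim.comp hhalf).add
    ((hAlim.comp (hdouble.comp hhalf)).const_mul 2)).const_mul (2 * (K + 1))
  simp only [mul_zero, add_zero] at h
  refine tendsto_of_tendsto_of_tendsto_of_le_of_le' tendsto_const_nhds h
    (.of_forall fun n => mul_nonneg (norm_nonneg _) (Real.log_natCast_nonneg n)) ?_
  filter_upwards [eventually_ge_atTop 1] with N hN
  exact norm_mul_log_le (c := fun k : ℕ => coeff F k) hK0 hK hN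

end FourierNBV

theorem corollary2 (f : ℝ → ℝ)
    (hf : FourierNBV.MemL2pi (fun x => (f x : ℂ)))
    (hc : FourierNBV.NBVS (fun n : ℕ => FourierNBV.coeff (fun x => (f x : ℂ)) (n : ℤ))) :
    Filter.Tendsto
        (fun n : ℕ => FourierNBV.normL
          (fun x => (f x : ℂ) - FourierNBV.partialSum (fun y => (f y : ℂ)) n x))
        Filter.atTop (nhds 0) ↔
      Filter.Tendsto
        (fun n : ℕ => FourierNBV.coeff (fun x => (f x : ℂ)) (n : ℤ) * (Real.log (n : ℝ) : ℂ))
        Filter.atTop (nhds 0) := by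
  obtain ⟨⟨θ, hθ, hs⟩, K, hK0, hK⟩ := hc
  rw [tendsto_zero_iff_norm_tendsto_zero (f := fun n : ℕ =>
    FourierNBV.coeff (fun x => (f x : ℂ)) (n : ℤ) * (Real.log (n : ℝ) : ℂ))]
  -- `log n ≥ 0` for every natural `n`, including the default `log 0 = 0`, so the logarithm is its
  -- own norm.
  simp_rw [norm_mul, Complex.norm_real, Real.norm_of_nonneg (Real.log_natCast_nonneg _)]
  exact ⟨FourierNBV.tendsto_coeff_mul_log hK0 hf.2 hθ hs hK,
    FourierNBV.tendsto_normL_sub_partialSum hK0 hf.2 hK⟩
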